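/- **Proposition (Memorization).** Let $d,n\ge 1$, let $K\subseteq[-1,1]^d$ be a compact set with positive Lebesgue measure, and let $P$ be the uniform distribution over $K$. Let $\sigma(z)=\max(z,0)$, and let $\rho_0$ be a probability measure on pairs $(\mathbf{w},b)\in\mathbb{R}^d\times\mathbb{R}$ such that $\|\mathbf{w}\|_1+|b|\le 1$ for $\rho_0$-almost all $(\mathbf{w},b)$ and such that $\rho_0$ covers all directions: for every $(\mathbf{w},b)\ne\mathbf{0}$ there is $\lambda>0$ with $\lambda(\mathbf{w},b)$ in the support of $\rho_0$. For $a\in L^2(\rho_0)$ put $$V_a(\mathbf{x})=\mathbb{E}_{\rho_0(\mathbf{w},b)}\big[a(\mathbf{w},b)\,\sigma(\mathbf{w}\cdot\mathbf{x}+b)\big],$$ and for a function $V$ on $K$ let $\|V\|_{\mathcal H}=\inf\{\|a\|_{L^2(\rho_0)} : V=V_a \text{ on } K\}$ (with $\inf\emptyset=\infty$). The distribution generated by a potential $V$ is $\frac1Z e^{-V}P$ with $Z=\mathbb{E}_P[e^{-V}]$. Let $Q_*$ be the distribution generated by a potential $V_*$ with $\|V_*\|_{\mathcal H}<\infty$.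 Let $\mathbf{x}_1,\dots,\mathbf{x}_n$ be sample points in the support of $Q_*$ (which holds with probability one for i.i.d. samples of $Q_*$), and let $Q_*^{(n)}=\frac1n\sum_{i=1}^n\delta_{\mathbf{x}_i}$. Let $a^{(n)}_t$, $t\ge 0$, be a trajectory in $L^2(\rho_0)$, with arbitrary initial value $a^{(n)}_0 \in L^2(\rho_0)$, of the gradient flow $\frac{d}{dt}a^{(n)}_t=-\nabla L^{(n)}(a^{(n)}_t)$ of the empirical loss $$L^{(n)}(a)=\mathbb{E}_{Q_*^{(n)}}[V_a]+\log\mathbb{E}_P[e^{-V_a}],$$ let $V^{(n)}_t=V_{a^{(n)}_t}$, and let $Q^{(n)}_t$ be the distribution generated by $V^{(n)}_t$. A weak limit (point) of $Q^{(n)}_t$ is a probability measure each of whose weak neighbourhoods contains $Q^{(n)}_t$ for arbitrarily large $t$. Then: 1. If $Q^{(n)}_t$ has exactly one weak limit point, then $Q^{(n)}_t$ converges weakly to $Q_*^{(n)}$ as $t\to\infty$. 2. $Q_*$ is not a weak limit point of $Q^{(n)}_t$. Moreover $$\lim_{t\to\infty}KL\big(Q_*\,\|\,Q^{(n)}_t\big)=\lim_{t\to\infty}\|V^{(n)}_t\|_{\mathcal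 H}=\infty,$$ and consequently $\|a^{(n)}_t\|_{L^2(\rho_0)}\to\infty$ as well. -/

import Mathlib

open MeasureTheory Filter Topology Set
open scoped ENNReal Gradient

/-- The parameter space of pairs `(w, b)`, where `w` is a weight vector and `b` a bias. -/
abbrev Param (d : ℕ) : Type := (Fin d → ℝ) × ℝ

/-- The `l¹` norm `‖w‖₁ + |b|` of a parameter. -/
def l1Norm {d : ℕ} (θ : Param d) : ℝ := ∑ i, |θ.1 i| + |θ.2|

/-- The ReLU feature `σ(w · x + b)`, with `σ(z) = max z 0`. -/
def reluFeature {d : ℕ} (θ : Param d) (x : Fin d → ℝ) : ℝ :=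
  max (∑ i, θ.1 i * x i + θ.2) 0

/-- `ρ₀` covers all directions: every ray from the origin meets the support of `ρ₀` at a
nonzero point. -/
def CoversAllDirections {d : ℕ} (ρ₀ : Measure (Param d)) : Prop :=
  ∀ θ : Param d, θ ≠ 0 → ∃ c : ℝ, 0 < c ∧ c • θ ∈ ρ₀.support

/-- The random feature potential `V(x) = 𝔼_{ρ₀(w,b)}[a(w,b) σ(w · x + b)]` with parameter
function `a ∈ L²(ρ₀)`. -/
noncomputable def potential {d : ℕ} (ρ₀ : Measure (Param d)) (a : Lp ℝ 2 ρ₀)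
    (x : Fin d → ℝ) : ℝ :=
  ∫ θ, a θ * reluFeature θ x ∂ρ₀

/-- The RKHS norm of `V : K → ℝ`: the least `L²(ρ₀)` norm of a parameter function that
represents `V` on `K` (infinite if there is none). -/
noncomputable def rkhsNorm {d : ℕ} (ρ₀ : Measure (Param d)) (K : Set (Fin d → ℝ))
    (V : (Fin d → ℝ) → ℝ) : ℝ≥0∞ :=
  ⨅ (a : Lp ℝ 2 ρ₀) (_ : ∀ x ∈ K, V x = potential ρ₀ a x), eLpNorm a 2 ρ₀

/-- The uniform distribution over `K`: normalized Lebesgue measure restricted to `K`. -/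
noncomputable def uniformDist {d : ℕ} (K : Set (Fin d → ℝ)) : Measure (Fin d → ℝ) :=
  (volume K)⁻¹ • volume.restrict K

/-- `Q` is generated by the potential `V` and the base distribution `P`:
`Q = Z⁻¹ e^{-V} P` with `Z = 𝔼_P[e^{-V}]`. -/
def IsDistributionOfPotential {d : ℕ} (P : Measure (Fin d → ℝ)) (V : (Fin d → ℝ) → ℝ)
    (Q : ProbabilityMeasure (Fin d → ℝ)) : Prop :=
  (Q : Measure (Fin d → ℝ)) =
    P.withDensity fun x => ENNReal.ofReal (Real.exp (-V x) / ∫ y, Real.exp (-V y) ∂P)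

/-- The empirical distribution `n⁻¹ ∑ᵢ δ_{xᵢ}` of `n ≥ 1` sample points. -/
noncomputable def empiricalDist {d n : ℕ} (hn : 0 < n) (x : Fin n → Fin d → ℝ) :
    ProbabilityMeasure (Fin d → ℝ) :=
  ⟨(n : ℝ≥0∞)⁻¹ • ∑ i, Measure.dirac (x i), ⟨by
    simp [ENNReal.inv_mul_cancel (Nat.cast_ne_zero.mpr hn.ne') (ENNReal.natCast_ne_top n)]⟩⟩

/-- The training objective `𝔼_Q[V] + log 𝔼_P[e^{-V}]` for the data distribution `Q`. -/
noncomputable def biasLoss {d : ℕ} (P Q : Measure (Fin d → ℝ)) (V : (Fin d → ℝ) → ℝ) : ℝ :=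
  ∫ x, V x ∂Q + Real.log (∫ x, Real.exp (-V x) ∂P)

/-- `a` is a trajectory, for times `t ≥ 0`, of the gradient flow `da/dt = -∇L(a)` of `L` on a
Hilbert space. -/
def IsGradientFlow {E : Type*} [NormedAddCommGroup E] [InnerProductSpace ℝ E] [CompleteSpace E]
    (L : E → ℝ) (a : ℝ → E) : Prop :=
  ∀ t : ℝ, 0 ≤ t → HasDerivWithinAt a (-∇ L (a t)) (Ici 0) t

/-- `ν` is a weak limit point of the trajectory `Q t` as `t → ∞`: every weak neighbourhood of
`ν` is visited at arbitrarily large times. -/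
def IsWeakLimitPoint {d : ℕ} (Q : ℝ → ProbabilityMeasure (Fin d → ℝ))
    (ν : ProbabilityMeasure (Fin d → ℝ)) : Prop :=
  MapClusterPt ν atTop Q

/-! Let φ(x) ∈ L²(ρ₀) be the ReLU feature at x, so that V_a(x) = ⟪φ(x), a⟫. The empirical loss is
⟪m, a⟫ + log 𝔼_P[exp(-⟪φ, a⟫)], where m is the mean of φ over the samples. It is convex, and its
gradient m - 𝔼_{Q_a}[φ] is the moment mismatch between the samples and the generated distribution
Q_a.

The heart of the proof is that this gradient tends to zero, although the loss has no minimizer and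
is not assumed bounded below. Along a convex flow the gradient norm decreases, so T‖∇L(a_T)‖² ≤
L(a_0) - L(a_T), and a_T moves at most linearly in T. The samples lie in the support of P, so L(c) ≥
-C_r - r‖c‖ for every r > 0 (`exists_le_empiricalLoss`). Dividing by T and taking r small gives
`IsGradientFlow.tendsto_norm_gradient`.

Hence expectations of every V_c under Q_t converge to their sample averages. Such expectations
determine a measure on the cube (`measure_ext_of_integral_potential`), and compactness upgrades this
to weak convergence to the empirical distribution. The rest follows because that limit has atoms and
P has none: a bounded RKHS norm would bound the densities, and a bounded divergence from Q_* would
keep mass away from the samples. -/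

section GradientFlow

/-! ### Gradient flow of a convex function on a Hilbert space. -/

variable {E : Type*} [NormedAddCommGroup E] [InnerProductSpace ℝ E] [CompleteSpace E]
  {L : E → ℝ} {G : E → E} {a : ℝ → E}

lemma IsGradientFlow.hasDerivWithinAt (ha : IsGradientFlow L a)
    (hG : ∀ c, HasGradientAt L (G c) c) {t : ℝ} (ht : 0 ≤ t) :
    HasDerivWithinAt a (-G (a t)) (Ici 0) t := by
  have := ha t ht
  rwa [(hG (a t)).gradient] at this

/-- Two points moving along the same convex gradient flow approach each other. -/
lemma IsGradientFlow.antitoneOn_norm_sub (ha : IsGradientFlow L a)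
    (hG : ∀ c, HasGradientAt L (G c) c)
    (hconv : ∀ c c', L c + inner ℝ (G c) (c' - c) ≤ L c') {h : ℝ} (hh : 0 ≤ h) :
    AntitoneOn (fun t => ‖a (t + h) - a t‖ ^ 2) (Ici 0) := by
  have hd : ∀ t ∈ Ici (0 : ℝ), HasDerivWithinAt (fun t => ‖a (t + h) - a t‖ ^ 2)
      (2 * inner ℝ (a (t + h) - a t) (-G (a (t + h)) - -G (a t))) (Ici 0) t := by
    intro t ht
    have h1 : HasDerivWithinAt (fun t => a (t + h)) (-G (a (t + h))) (Ici 0) t := by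
      have h2 := ha.hasDerivWithinAt hG (t := t + h) (add_nonneg ht hh)
      have h3 : HasDerivWithinAt (fun t : ℝ => t + h) 1 (Ici 0) t :=
        ((hasDerivAt_id t).add_const h).hasDerivWithinAt
      have h4 := h2.scomp t h3 (fun s hs => add_nonneg hs hh)
      rw [one_smul] at h4
      exact h4
    exact (h1.sub (ha.hasDerivWithinAt hG ht)).norm_sq
  refine antitoneOn_of_hasDerivWithinAt_nonpos (convex_Ici 0)
    (fun t ht => (hd t ht).continuousWithinAt)
    (fun t ht => (hd t (interior_subset ht)).mono interior_subset) fun t _ => ?_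
  -- Adding the two tangent inequalities shows that `G` is a monotone operator.
  have e1 := hconv (a t) (a (t + h))
  have e2 := hconv (a (t + h)) (a t)
  rw [← neg_sub (a (t + h)) (a t), inner_neg_right] at e2
  have e3 : inner ℝ (a (t + h) - a t) (-G (a (t + h)) - -G (a t))
      = inner ℝ (G (a t)) (a (t + h) - a t) - inner ℝ (G (a (t + h))) (a (t + h) - a t) := by
    rw [inner_sub_right, inner_neg_right, inner_neg_right, real_inner_comm,
      real_inner_comm (G (a t))]
    ring
  rw [e3]
  linarith

/-- The norm of the gradient decreases along a convex gradient flow. -/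
lemma IsGradientFlow.norm_gradient_antitoneOn (ha : IsGradientFlow L a)
    (hG : ∀ c, HasGradientAt L (G c) c)
    (hconv : ∀ c c', L c + inner ℝ (G c) (c' - c) ≤ L c') :
    AntitoneOn (fun t => ‖G (a t)‖) (Ici 0) := by
  -- The speed ‖G (a t)‖ is a limit of difference quotients, each of which decreases in t for fixed
  -- h.
  have key : ∀ t ∈ Ici (0 : ℝ), Tendsto (fun h : ℝ => h⁻¹ * ‖a (t + h) - a t‖) (𝓝[>] 0)
      (𝓝 ‖G (a t)‖) := by
    intro t ht
    have h1 : HasDerivWithinAt a (-G (a t)) (Ioi t) t :=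
      (ha.hasDerivWithinAt hG ht).mono fun s hs => mem_Ici.2 ((mem_Ici.1 ht).trans (mem_Ioi.1 hs).le)
    have h2 := (hasDerivWithinAt_iff_tendsto_slope' self_notMem_Ioi).1 h1
    have h3 : Tendsto (fun h : ℝ => t + h) (𝓝[>] 0) (𝓝[>] t) := by
      refine tendsto_nhdsWithin_iff.2 ⟨?_, ?_⟩
      · have : Tendsto (fun h : ℝ => t + h) (𝓝 0) (𝓝 (t + 0)) :=
          (continuous_const_add t).tendsto 0
        rw [add_zero] at this
        exact this.mono_left nhdsWithin_le_nhds
      · filter_upwards [self_mem_nhdsWithin] with h hh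
        simpa using hh
    have h4 := (h2.comp h3).norm
    rw [norm_neg] at h4
    refine h4.congr' ?_
    filter_upwards [self_mem_nhdsWithin] with h hh
    have hh' : (0 : ℝ) < h := hh
    simp [slope_def_module, norm_smul, abs_of_pos hh']
  intro s hs t ht hst
  refine le_of_tendsto_of_tendsto (key t ht) (key s hs) ?_
  filter_upwards [self_mem_nhdsWithin] with h hh
  have hh' : (0 : ℝ) < h := hh
  have := ha.antitoneOn_norm_sub hG hconv hh'.le hs ht hst
  have := abs_le_of_sq_le_sq this (norm_nonneg _)
  rw [abs_norm] at this
  gcongr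

lemma IsGradientFlow.norm_sub_le (ha : IsGradientFlow L a)
    (hG : ∀ c, HasGradientAt L (G c) c)
    (hconv : ∀ c c', L c + inner ℝ (G c) (c' - c) ≤ L c') {T : ℝ} (hT : 0 ≤ T) :
    ‖a T - a 0‖ ≤ ‖G (a 0)‖ * T := by
  have := norm_image_sub_le_of_norm_deriv_le_segment' (f := a) (a := 0) (b := T)
    (f' := fun t => -G (a t)) (C := ‖G (a 0)‖)
    (fun t ht => (ha.hasDerivWithinAt hG ht.1).mono Icc_subset_Ici_self)
    (fun t ht => by
      rw [norm_neg]
      exact ha.norm_gradient_antitoneOn hG hconv self_mem_Ici ht.1 ht.1) T ⟨hT, le_rfl⟩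
  simpa using this

/-- The loss decreases at rate ‖G (a t)‖², which up to time T is at least its value at T. -/
lemma IsGradientFlow.mul_norm_gradient_sq_le (ha : IsGradientFlow L a)
    (hG : ∀ c, HasGradientAt L (G c) c)
    (hconv : ∀ c c', L c + inner ℝ (G c) (c' - c) ≤ L c') {T : ℝ} (hT : 0 ≤ T) :
    L (a T) + T * ‖G (a T)‖ ^ 2 ≤ L (a 0) := by
  have hd : ∀ t ∈ Icc 0 T, HasDerivWithinAt (fun t => L (a t) + t * ‖G (a T)‖ ^ 2)
      (-‖G (a t)‖ ^ 2 + ‖G (a T)‖ ^ 2) (Icc 0 T) t := by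
    intro t ht
    have h1 := (hG (a t)).hasFDerivAt.comp_hasDerivWithinAt t (ha.hasDerivWithinAt hG ht.1)
    have h2 := ((hasDerivAt_id t).mul_const (‖G (a T)‖ ^ 2)).hasDerivWithinAt (s := Ici 0)
    have h3 := (h1.add h2).mono (fun s hs => hs.1 : Icc 0 T ⊆ Ici 0)
    exact h3.congr_deriv (by simp)
  have := antitoneOn_of_hasDerivWithinAt_nonpos (convex_Icc 0 T)
    (fun t ht => (hd t ht).continuousWithinAt)
    (fun t ht => (hd t (interior_subset ht)).mono interior_subset) (fun t ht => by
      have ht' := interior_subset ht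
      have h1 := ha.norm_gradient_antitoneOn hG hconv ht'.1 hT ht'.2
      have h2 := pow_le_pow_left₀ (norm_nonneg _) h1 2
      linarith)
    (left_mem_Icc.2 hT) (right_mem_Icc.2 hT) hT
  simpa using this

/-- Along the gradient flow of a convex function whose negative part grows sublinearly, the
gradient tends to zero. -/
lemma IsGradientFlow.tendsto_norm_gradient (ha : IsGradientFlow L a)
    (hG : ∀ c, HasGradientAt L (G c) c)
    (hconv : ∀ c c', L c + inner ℝ (G c) (c' - c) ≤ L c')
    (hlow : ∀ r > 0, ∃ C, ∀ c, -C - r * ‖c‖ ≤ L c) :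
    Tendsto (fun t => G (a t)) atTop (𝓝 0) := by
  rw [Metric.tendsto_nhds]
  intro ε hε
  set g := ‖G (a 0)‖
  have hg : 0 ≤ g := norm_nonneg _
  -- The drift term r·g·T may use up half of T·ε²; the constants use less than the other half once T
  -- is large. The `g + 1` avoids dividing by zero.
  obtain ⟨r, hr, hrg⟩ : ∃ r > 0, r * g < ε ^ 2 / 2 :=
    ⟨ε ^ 2 / 2 / (g + 1), by positivity, by
      rw [div_mul_eq_mul_div, div_lt_iff₀ (by positivity)]
      exact mul_lt_mul_of_pos_left (by linarith) (by positivity)⟩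
  obtain ⟨C, hC⟩ := hlow r hr
  filter_upwards [eventually_gt_atTop 0,
    eventually_gt_atTop ((L (a 0) + C + r * ‖a 0‖) / (ε ^ 2 / 2))] with T hT hT'
  rw [dist_zero_right]
  have h1 := ha.mul_norm_gradient_sq_le hG hconv hT.le
  have h2 := ha.norm_sub_le hG hconv hT.le
  have h3 := hC (a T)
  have h4 : ‖a T‖ ≤ ‖a 0‖ + g * T := by
    have := norm_le_norm_add_norm_sub (a 0) (a T)
    rw [norm_sub_rev] at this
    linarith
  have h5 : r * ‖a T‖ ≤ r * (‖a 0‖ + g * T) := by gcongr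
  rw [div_lt_iff₀ (by positivity)] at hT'
  have h6 : T * ‖G (a T)‖ ^ 2 < T * ε ^ 2 := by
    have : T * (r * g) < T * (ε ^ 2 / 2) := mul_lt_mul_of_pos_left hrg hT
    linarith
  exact lt_of_pow_lt_pow_left₀ 2 hε.le (lt_of_mul_lt_mul_left h6 hT.le)

end GradientFlow

/-! ### The log-partition loss: gradient and convexity. -/

section GibbsLoss

variable {E X : Type*} [NormedAddCommGroup E] [InnerProductSpace ℝ E]
  [MeasurableSpace X] {P : Measure X} {φ : X → E}

/-- The density with respect to `P` of the Gibbs measure of the linear potential `⟪φ x, c⟫`. -/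
noncomputable def gibbsDensity (P : Measure X) (φ : X → E) (c : E) (x : X) : ℝ :=
  Real.exp (-inner ℝ (φ x) c) / ∫ y, Real.exp (-inner ℝ (φ y) c) ∂P

/-- The gradient at `c` of `⟪m, c⟫ + log 𝔼_P[exp (-⟪φ x, c⟫)]`. -/
noncomputable def gibbsGradient (P : Measure X) (φ : X → E) (m c : E) : E :=
  m - ∫ x, gibbsDensity P φ c x • φ x ∂P

lemma aestronglyMeasurable_exp_neg_inner (hφ : AEStronglyMeasurable φ P) (c : E) :
    AEStronglyMeasurable (fun x => Real.exp (-inner ℝ (φ x) c)) P :=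
  Real.continuous_exp.comp_aestronglyMeasurable (hφ.inner aestronglyMeasurable_const).neg

lemma abs_inner_le_of_norm_le_one {u : E} (hu : ‖u‖ ≤ 1) (c : E) : |inner ℝ u c| ≤ ‖c‖ :=
  (abs_real_inner_le_norm _ _).trans (mul_le_of_le_one_left (norm_nonneg c) hu)

lemma exp_neg_inner_le {u : E} (hu : ‖u‖ ≤ 1) (c : E) :
    Real.exp (-inner ℝ u c) ≤ Real.exp ‖c‖ :=
  Real.exp_le_exp.2 ((neg_le_abs _).trans (abs_inner_le_of_norm_le_one hu c))

lemma le_exp_neg_inner {u : E} (hu : ‖u‖ ≤ 1) (c : E) :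
    Real.exp (-‖c‖) ≤ Real.exp (-inner ℝ u c) :=
  Real.exp_le_exp.2 (neg_le_neg ((le_abs_self _).trans (abs_inner_le_of_norm_le_one hu c)))

lemma gibbsDensity_nonneg (c : E) (x : X) : 0 ≤ gibbsDensity P φ c x :=
  div_nonneg (Real.exp_pos _).le (integral_nonneg fun _ => (Real.exp_pos _).le)

variable [IsProbabilityMeasure P]

lemma integrable_exp_neg_inner (hφ : AEStronglyMeasurable φ P) (hφ1 : ∀ᵐ x ∂P, ‖φ x‖ ≤ 1)
    (c : E) : Integrable (fun x => Real.exp (-inner ℝ (φ x) c)) P := by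
  refine Integrable.of_bound (aestronglyMeasurable_exp_neg_inner hφ c) (Real.exp ‖c‖) ?_
  filter_upwards [hφ1] with x hx
  rw [Real.norm_of_nonneg (Real.exp_pos _).le]
  exact exp_neg_inner_le hx c

lemma le_integral_exp_neg_inner (hφ : AEStronglyMeasurable φ P) (hφ1 : ∀ᵐ x ∂P, ‖φ x‖ ≤ 1)
    (c : E) : Real.exp (-‖c‖) ≤ ∫ x, Real.exp (-inner ℝ (φ x) c) ∂P := by
  have := integral_mono_ae (integrable_const (Real.exp (-‖c‖)))
    (integrable_exp_neg_inner hφ hφ1 c) (by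
      filter_upwards [hφ1] with x hx
      exact le_exp_neg_inner hx c)
  simpa using this

lemma integral_exp_neg_inner_pos (hφ : AEStronglyMeasurable φ P) (hφ1 : ∀ᵐ x ∂P, ‖φ x‖ ≤ 1)
    (c : E) : 0 < ∫ x, Real.exp (-inner ℝ (φ x) c) ∂P :=
  (Real.exp_pos _).trans_le (le_integral_exp_neg_inner hφ hφ1 c)

/-- The numerator is at most exp ‖c‖ and the partition function at least exp (-‖c‖). This is what
turns bounded norms into bounded densities. -/
lemma gibbsDensity_le (hφ : AEStronglyMeasurable φ P) (hφ1 : ∀ᵐ x ∂P, ‖φ x‖ ≤ 1)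
    (c : E) {x : X} (hx : ‖φ x‖ ≤ 1) : gibbsDensity P φ c x ≤ Real.exp (2 * ‖c‖) := by
  rw [gibbsDensity, div_le_iff₀ (integral_exp_neg_inner_pos hφ hφ1 c)]
  calc Real.exp (-inner ℝ (φ x) c) ≤ Real.exp ‖c‖ := exp_neg_inner_le hx c
    _ = Real.exp (2 * ‖c‖) * Real.exp (-‖c‖) := by rw [← Real.exp_add]; ring_nf
    _ ≤ _ := by gcongr; exact le_integral_exp_neg_inner hφ hφ1 c

lemma integrable_gibbsDensity (hφ : AEStronglyMeasurable φ P) (hφ1 : ∀ᵐ x ∂P, ‖φ x‖ ≤ 1)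
    (c : E) : Integrable (gibbsDensity P φ c) P :=
  (integrable_exp_neg_inner hφ hφ1 c).div_const _

lemma integral_gibbsDensity (hφ : AEStronglyMeasurable φ P) (hφ1 : ∀ᵐ x ∂P, ‖φ x‖ ≤ 1)
    (c : E) : ∫ x, gibbsDensity P φ c x ∂P = 1 := by
  simp only [gibbsDensity]
  rw [integral_div, div_self (integral_exp_neg_inner_pos hφ hφ1 c).ne']

lemma integrable_gibbsDensity_smul (hφ : AEStronglyMeasurable φ P)
    (hφ1 : ∀ᵐ x ∂P, ‖φ x‖ ≤ 1) (c : E) :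
    Integrable (fun x => gibbsDensity P φ c x • φ x) P :=
  (integrable_gibbsDensity hφ hφ1 c).smul_bdd 1 hφ hφ1

lemma hasFDerivAt_integral_exp_neg_inner (hφ : AEStronglyMeasurable φ P)
    (hφ1 : ∀ᵐ x ∂P, ‖φ x‖ ≤ 1) (c : E) :
    HasFDerivAt (fun c => ∫ x, Real.exp (-inner ℝ (φ x) c) ∂P)
      (∫ x, Real.exp (-inner ℝ (φ x) c) • -innerSL ℝ (φ x) ∂P) c := by
  refine hasFDerivAt_integral_of_dominated_of_fderiv_le
    (bound := fun _ => Real.exp (‖c‖ + 1))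
    (F' := fun c x => Real.exp (-inner ℝ (φ x) c) • -innerSL ℝ (φ x))
    (Metric.ball_mem_nhds c one_pos)
    (Eventually.of_forall fun c => aestronglyMeasurable_exp_neg_inner hφ c)
    (integrable_exp_neg_inner hφ hφ1 c)
    ((aestronglyMeasurable_exp_neg_inner hφ c).smul
      ((innerSL ℝ).continuous.comp_aestronglyMeasurable hφ).neg) ?_ (integrable_const _) ?_
  · filter_upwards [hφ1] with x hx b hb
    rw [norm_smul, norm_neg, innerSL_apply_norm, Real.norm_of_nonneg (Real.exp_pos _).le]
    calc _ ≤ Real.exp (-inner ℝ (φ x) b) * 1 := by gcongr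
      _ ≤ Real.exp ‖b‖ := by rw [mul_one]; exact exp_neg_inner_le hx b
      _ ≤ _ := by
        have := norm_le_norm_add_norm_sub c b
        rw [Metric.mem_ball, dist_eq_norm, norm_sub_rev] at hb
        gcongr
        linarith
  · filter_upwards [hφ1] with x hx b hb
    exact ((innerSL ℝ (φ x)).hasFDerivAt (x := b)).neg.exp

variable [CompleteSpace E]

lemma inner_gibbsGradient (hφ : AEStronglyMeasurable φ P) (hφ1 : ∀ᵐ x ∂P, ‖φ x‖ ≤ 1)
    (m c b : E) : inner ℝ (gibbsGradient P φ m c) b =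
      inner ℝ m b - ∫ x, gibbsDensity P φ c x * inner ℝ (φ x) b ∂P := by
  rw [gibbsGradient, inner_sub_left, real_inner_comm b (∫ x, _ ∂P),
    ← integral_inner (integrable_gibbsDensity_smul hφ hφ1 c)]
  simp [real_inner_smul_right, real_inner_comm b]

lemma hasGradientAt_gibbsLoss (hφ : AEStronglyMeasurable φ P) (hφ1 : ∀ᵐ x ∂P, ‖φ x‖ ≤ 1)
    (m c : E) :
    HasGradientAt (fun c => inner ℝ m c + Real.log (∫ x, Real.exp (-inner ℝ (φ x) c) ∂P))
      (gibbsGradient P φ m c) c := by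
  rw [hasGradientAt_iff_hasFDerivAt]
  have h1 := ((innerSL ℝ m).hasFDerivAt (x := c)).add
    ((hasFDerivAt_integral_exp_neg_inner hφ hφ1 c).log (integral_exp_neg_inner_pos hφ hφ1 c).ne')
  refine h1.congr_fderiv ?_
  ext b
  have hint : Integrable (fun x => Real.exp (-inner ℝ (φ x) c) • -innerSL ℝ (φ x)) P := by
    refine (integrable_exp_neg_inner hφ hφ1 c).smul_bdd 1
      ((innerSL ℝ).continuous.comp_aestronglyMeasurable hφ).neg ?_
    filter_upwards [hφ1] with x hx
    rwa [norm_neg, innerSL_apply_norm]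
  rw [InnerProductSpace.toDual_apply_apply, inner_gibbsGradient hφ hφ1, add_apply,
    smul_apply, ContinuousLinearMap.integral_apply hint]
  simp only [innerSL_apply_apply, smul_apply, neg_apply,
    smul_eq_mul, mul_neg, integral_neg, gibbsDensity, div_mul_eq_mul_div, integral_div]
  ring

/-- Jensen's inequality: Z'/Z is the Gibbs mean of exp (-⟪φ, c' - c⟫), hence at least exp (-A). -/
lemma gibbsLoss_convex (hφ : AEStronglyMeasurable φ P) (hφ1 : ∀ᵐ x ∂P, ‖φ x‖ ≤ 1)
    (m c c' : E) :
    inner ℝ m c + Real.log (∫ x, Real.exp (-inner ℝ (φ x) c) ∂P)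
        + inner ℝ (gibbsGradient P φ m c) (c' - c) ≤
      inner ℝ m c' + Real.log (∫ x, Real.exp (-inner ℝ (φ x) c') ∂P) := by
  rw [inner_gibbsGradient hφ hφ1, inner_sub_right]
  set Z := ∫ x, Real.exp (-inner ℝ (φ x) c) ∂P with hZ
  set Z' := ∫ x, Real.exp (-inner ℝ (φ x) c') ∂P with hZ'
  set A := ∫ x, gibbsDensity P φ c x * inner ℝ (φ x) (c' - c) ∂P with hA
  have hZpos : 0 < Z := integral_exp_neg_inner_pos hφ hφ1 c
  have hZpos' : 0 < Z' := integral_exp_neg_inner_pos hφ hφ1 c'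
  have hi : Integrable (fun x => gibbsDensity P φ c x * inner ℝ (φ x) (c' - c)) P := by
    refine (integrable_gibbsDensity hφ hφ1 c).mul_bdd (c := ‖c' - c‖)
      (hφ.inner aestronglyMeasurable_const) ?_
    filter_upwards [hφ1] with x hx
    exact abs_inner_le_of_norm_le_one hx _
  have h1 : Real.exp (-A) ≤ Z' / Z := by
    -- The integrand is the tangent line of u ↦ exp (-u) at u = A, times the Gibbs density.
    have h2 : ∫ x, (Real.exp (-A) * ((1 + A) * gibbsDensity P φ c x
        - gibbsDensity P φ c x * inner ℝ (φ x) (c' - c))) ∂P = Real.exp (-A) := by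
      rw [integral_const_mul, integral_sub ((integrable_gibbsDensity hφ hφ1 c).const_mul _) hi,
        integral_const_mul, integral_gibbsDensity hφ hφ1, ← hA]
      ring
    rw [← h2, hZ', ← integral_div]
    refine integral_mono ((((integrable_gibbsDensity hφ hφ1 c).const_mul _).sub hi).const_mul _)
      ((integrable_exp_neg_inner hφ hφ1 c').div_const _) fun x => ?_
    have h3 := Real.add_one_le_exp (A - inner ℝ (φ x) (c' - c))
    have h4 : Real.exp (-inner ℝ (φ x) c') / Z = Real.exp (-A) *
        (gibbsDensity P φ c x * Real.exp (A - inner ℝ (φ x) (c' - c))) := by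
      rw [gibbsDensity, ← hZ, div_mul_eq_mul_div, mul_div_assoc', ← Real.exp_add, ← Real.exp_add,
        inner_sub_right]
      ring_nf
    dsimp only
    rw [h4]
    have h5 := mul_le_mul_of_nonneg_left h3 (gibbsDensity_nonneg (P := P) (φ := φ) c x)
    gcongr
    linarith
  have h6 := (Real.le_log_iff_exp_le (div_pos hZpos' hZpos)).2 h1
  rw [Real.log_div hZpos'.ne' hZpos.ne'] at h6
  linarith

end GibbsLoss

/-! ### ReLU features as a 1-Lipschitz map into L²(ρ₀). -/

section ReluFeature

variable {d : ℕ}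

lemma l1Norm_le (θ : Param d) : l1Norm θ ≤ (d + 1) * ‖θ‖ := by
  have h1 : ∑ i, |θ.1 i| ≤ ∑ _i : Fin d, ‖θ‖ :=
    Finset.sum_le_sum fun i _ => (norm_le_pi_norm θ.1 i).trans (norm_fst_le θ)
  have h2 : |θ.2| ≤ ‖θ‖ := norm_snd_le θ
  simp only [Finset.sum_const, Finset.card_univ, Fintype.card_fin, nsmul_eq_mul] at h1
  unfold l1Norm
  linarith

lemma reluFeature_nonneg (θ : Param d) (x : Fin d → ℝ) : 0 ≤ reluFeature θ x := le_max_right _ _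

lemma reluFeature_smul {c : ℝ} (hc : 0 ≤ c) (θ : Param d) (x : Fin d → ℝ) :
    reluFeature (c • θ) x = c * reluFeature θ x := by
  simp only [reluFeature, Prod.smul_fst, Prod.smul_snd, Pi.smul_apply, smul_eq_mul, mul_assoc,
    ← Finset.mul_sum, ← mul_add]
  rw [mul_max_of_nonneg _ _ hc, mul_zero]

lemma continuous_reluFeature (x : Fin d → ℝ) : Continuous fun θ : Param d => reluFeature θ x := by
  unfold reluFeature
  fun_prop

lemma continuous_reluFeature_right (θ : Param d) : Continuous (reluFeature θ) := by
  unfold reluFeature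
  fun_prop

lemma abs_sum_mul_le (w x : Fin d → ℝ) : |∑ i, w i * x i| ≤ (∑ i, |w i|) * ‖x‖ := by
  refine (Finset.abs_sum_le_sum_abs _ _).trans ?_
  rw [Finset.sum_mul]
  refine Finset.sum_le_sum fun i _ => ?_
  rw [abs_mul]
  gcongr
  exact norm_le_pi_norm x i

lemma abs_reluFeature_sub_le (θ : Param d) (x y : Fin d → ℝ) :
    |reluFeature θ x - reluFeature θ y| ≤ l1Norm θ * ‖x - y‖ := by
  refine (abs_max_sub_max_le_abs _ _ _).trans ?_
  have h1 : ∑ i, θ.1 i * x i + θ.2 - (∑ i, θ.1 i * y i + θ.2) = ∑ i, θ.1 i * (x - y) i := by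
    simp [mul_sub, Finset.sum_sub_distrib]
  rw [h1]
  refine (abs_sum_mul_le _ _).trans ?_
  gcongr
  exact le_add_of_nonneg_right (abs_nonneg _)

lemma abs_reluFeature_sub_param_le (θ θ' : Param d) {x : Fin d → ℝ} (hx : ‖x‖ ≤ 1) :
    |reluFeature θ x - reluFeature θ' x| ≤ l1Norm (θ - θ') := by
  refine (abs_max_sub_max_le_abs _ _ _).trans ?_
  have h1 : ∑ i, θ.1 i * x i + θ.2 - (∑ i, θ'.1 i * x i + θ'.2)
      = ∑ i, (θ - θ').1 i * x i + (θ - θ').2 := by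
    simp only [Prod.fst_sub, Prod.snd_sub, Pi.sub_apply, sub_mul, Finset.sum_sub_distrib]
    ring
  rw [h1]
  refine (abs_add_le _ _).trans (add_le_add ((abs_sum_mul_le _ _).trans ?_) le_rfl)
  exact mul_le_of_le_one_right (Finset.sum_nonneg fun _ _ => abs_nonneg _) hx

lemma reluFeature_le (θ : Param d) {x : Fin d → ℝ} (hx : ‖x‖ ≤ 1) :
    reluFeature θ x ≤ l1Norm θ := by
  have h := abs_reluFeature_sub_param_le θ 0 hx
  simp only [reluFeature, sub_zero] at h ⊢
  simp only [Prod.fst_zero, Pi.zero_apply, zero_mul, Finset.sum_const_zero, Prod.snd_zero,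
    add_zero, max_self, sub_zero] at h
  exact (le_abs_self _).trans h

lemma norm_le_one_of_mem_cube {x : Fin d → ℝ} (hx : x ∈ Icc (-1 : Fin d → ℝ) 1) : ‖x‖ ≤ 1 :=
  (pi_norm_le_iff_of_nonneg zero_le_one).2 fun i => abs_le.2 ⟨hx.1 i, hx.2 i⟩

variable {ρ₀ : Measure (Param d)} [IsProbabilityMeasure ρ₀]

lemma memLp_reluFeature (hρ : ∀ᵐ θ ∂ρ₀, l1Norm θ ≤ 1) (x : Fin d → ℝ) :
    MemLp (fun θ => reluFeature θ x) 2 ρ₀ := by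
  refine MemLp.of_bound (continuous_reluFeature x).aestronglyMeasurable (‖x‖ + 1) ?_
  filter_upwards [hρ] with θ hθ
  have h1 := abs_reluFeature_sub_le θ x 0
  have h2 := reluFeature_le θ (x := 0) (by simp)
  rw [sub_zero] at h1
  have h3 : l1Norm θ * ‖x‖ ≤ ‖x‖ := mul_le_of_le_one_left (norm_nonneg x) hθ
  rw [Real.norm_of_nonneg (reluFeature_nonneg _ _)]
  linarith [le_abs_self (reluFeature θ x - reluFeature θ 0)]

/-- The feature `θ ↦ σ(w · x + b)` at `x`, as an element of `L²(ρ₀)`. -/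
noncomputable def featureLp (hρ : ∀ᵐ θ ∂ρ₀, l1Norm θ ≤ 1) (x : Fin d → ℝ) : Lp ℝ 2 ρ₀ :=
  (memLp_reluFeature hρ x).toLp _

lemma inner_featureLp (hρ : ∀ᵐ θ ∂ρ₀, l1Norm θ ≤ 1) (x : Fin d → ℝ) (c : Lp ℝ 2 ρ₀) :
    inner ℝ (featureLp hρ x) c = potential ρ₀ c x := by
  rw [L2.inner_def, potential]
  refine integral_congr_ae ?_
  filter_upwards [(memLp_reluFeature hρ x).coeFn_toLp] with θ hθ
  rw [featureLp, hθ]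
  rfl

lemma norm_featureLp_sub_le (hρ : ∀ᵐ θ ∂ρ₀, l1Norm θ ≤ 1) (x y : Fin d → ℝ) :
    ‖featureLp hρ x - featureLp hρ y‖ ≤ dist x y := by
  have h := Lp.norm_le_of_ae_bound (f := featureLp hρ x - featureLp hρ y) (C := dist x y)
    dist_nonneg (by
      filter_upwards [hρ, (memLp_reluFeature hρ x).coeFn_toLp,
        (memLp_reluFeature hρ y).coeFn_toLp, Lp.coeFn_sub (featureLp hρ x) (featureLp hρ y)]
        with θ hθ h1 h2 h3
      rw [h3, Pi.sub_apply, featureLp, featureLp, h1, h2, dist_eq_norm]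
      exact (abs_reluFeature_sub_le θ x y).trans (mul_le_of_le_one_left (norm_nonneg _) hθ))
  simpa [measureUnivNNReal] using h

lemma norm_featureLp_le (hρ : ∀ᵐ θ ∂ρ₀, l1Norm θ ≤ 1) {x : Fin d → ℝ} (hx : ‖x‖ ≤ 1) :
    ‖featureLp hρ x‖ ≤ 1 := by
  have h := Lp.norm_le_of_ae_bound (f := featureLp hρ x) (C := 1) zero_le_one (by
    filter_upwards [hρ, (memLp_reluFeature hρ x).coeFn_toLp] with θ hθ h1
    rw [featureLp, h1, Real.norm_of_nonneg (reluFeature_nonneg _ _)]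
    exact (reluFeature_le θ hx).trans hθ)
  simpa [measureUnivNNReal] using h

lemma continuous_featureLp (hρ : ∀ᵐ θ ∂ρ₀, l1Norm θ ≤ 1) : Continuous (featureLp hρ) :=
  LipschitzWith.continuous (K := 1) <| LipschitzWith.mk_one fun x y => by
    rw [dist_eq_norm]
    exact norm_featureLp_sub_le hρ x y

lemma continuous_potential (hρ : ∀ᵐ θ ∂ρ₀, l1Norm θ ≤ 1) (c : Lp ℝ 2 ρ₀) :
    Continuous (potential ρ₀ c) := by
  simp_rw [← funext (inner_featureLp hρ · c)]
  exact (continuous_featureLp hρ).inner continuous_const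

end ReluFeature

/-! ### Measures on the cube are determined by random feature potentials. -/

section Universality

/-- Difference quotients in b of max (s + b) 0 tend to indicators of rays, which determine a finite
measure. -/
lemma Real.measure_ext_of_integral_relu {μ ν : Measure ℝ} [IsFiniteMeasure μ] [IsFiniteMeasure ν]
    (hμ : Integrable id μ) (hν : Integrable id ν)
    (h : ∀ b : ℝ, ∫ s, max (s + b) 0 ∂μ = ∫ s, max (s + b) 0 ∂ν) : μ = ν := by
  -- A ramp rising from 0 at a - 1/(m+1) to 1 at a. Placed to the left of a, its limit is the
  -- indicator of the closed ray.
  let F : ℝ → ℕ → ℝ → ℝ := fun a m s => (m + 1) * (max (s + (-a + 1 / (m + 1))) 0 - max (s + -a) 0)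
  have hF : ∀ a (κ : Measure ℝ) [IsFiniteMeasure κ],
      Tendsto (fun m => ∫ s, F a m s ∂κ) atTop (𝓝 (κ.real (Ici a))) := by
    intro a κ _
    rw [← integral_indicator_one measurableSet_Ici]
    refine tendsto_integral_of_dominated_convergence (fun _ => 1)
      (fun m => (by fun_prop : Continuous (F a m)).aestronglyMeasurable) (integrable_const _)
      (fun m => Eventually.of_forall fun s => ?_) (Eventually.of_forall fun s => ?_)
    · have hm : (0 : ℝ) < m + 1 := by positivity
      rw [norm_mul, Real.norm_of_nonneg hm.le]
      calc _ ≤ ((m : ℝ) + 1) * |s + (-a + 1 / (m + 1)) - (s + -a)| := by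
            gcongr
            exact abs_max_sub_max_le_abs _ _ _
        _ = 1 := by
            rw [add_sub_add_left_eq_sub, add_sub_cancel_left, abs_of_pos (by positivity)]
            field_simp
    · by_cases hs : a ≤ s
      · refine tendsto_const_nhds.congr fun m => ?_
        have hm : (0 : ℝ) < 1 / (m + 1) := by positivity
        simp only [F, mem_Ici, hs, indicator_of_mem, Pi.one_apply]
        rw [max_eq_left (by linarith), max_eq_left (by linarith)]
        field_simp
        ring
      · have h1 : ∀ᶠ m : ℕ in atTop, 1 / ((m : ℝ) + 1) < a - s :=
          tendsto_one_div_add_atTop_nhds_zero_nat.eventually_lt_const (by linarith)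
        refine tendsto_const_nhds.congr' ?_
        filter_upwards [h1] with m hm
        rw [indicator_of_notMem (by simpa using hs)]
        simp only [F]
        rw [max_eq_right (by linarith), max_eq_right (by linarith)]
        simp
  have hint : ∀ (κ : Measure ℝ) [IsFiniteMeasure κ], Integrable id κ → ∀ b : ℝ,
      Integrable (fun s => max (s + b) 0) κ := fun κ _ hκ b =>
    (hκ.add (integrable_const b)).pos_part
  refine Measure.ext_of_Ici μ ν fun a => ?_
  rw [← measureReal_eq_measureReal_iff]
  refine tendsto_nhds_unique (hF a μ) ((hF a ν).congr fun m => ?_)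
  simp only [F]
  rw [integral_const_mul, integral_const_mul, integral_sub (hint μ hμ _) (hint μ hμ _),
    integral_sub (hint ν hν _) (hint ν hν _), h, h]

variable {d : ℕ}

/-- A probability measure on the cube is determined by its integrals of ReLU features. -/
lemma measure_ext_of_integral_reluFeature {μ ν : Measure (Fin d → ℝ)} [IsFiniteMeasure μ]
    [IsFiniteMeasure ν] (hμ : ∀ᵐ x ∂μ, ‖x‖ ≤ 1) (hν : ∀ᵐ x ∂ν, ‖x‖ ≤ 1)
    (h : ∀ θ, ∫ x, reluFeature θ x ∂μ = ∫ x, reluFeature θ x ∂ν) : μ = ν := by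
  refine Measure.ext_of_charFunDual ?_
  ext L
  have hint : ∀ κ : Measure (Fin d → ℝ), IsFiniteMeasure κ → (∀ᵐ x ∂κ, ‖x‖ ≤ 1) →
      Integrable id (κ.map L) := fun κ _ hκ => by
    rw [integrable_map_measure aestronglyMeasurable_id L.continuous.aemeasurable]
    refine Integrable.of_bound L.continuous.aestronglyMeasurable ‖L‖ ?_
    filter_upwards [hκ] with x hx
    exact (L.le_opNorm x).trans (mul_le_of_le_one_right (norm_nonneg _) hx)
  -- Cramér–Wold: a ReLU of L x + b is the feature with weights L (e_i), so all one-dimensional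
  -- marginals agree.
  have hL : μ.map L = ν.map L := by
    refine Real.measure_ext_of_integral_relu (hint μ inferInstance hμ) (hint ν inferInstance hν)
      fun b => ?_
    have hc : Continuous fun s : ℝ => max (s + b) 0 := by fun_prop
    rw [integral_map L.continuous.aemeasurable hc.aestronglyMeasurable,
      integral_map L.continuous.aemeasurable hc.aestronglyMeasurable]
    have h1 : ∀ x, max (L x + b) 0 = reluFeature (fun i => L (Pi.single i 1), b) x := fun x => by
      have h2 : L x = ∑ i, L (Pi.single i 1) * x i := by
        conv_lhs => rw [← Finset.univ_sum_single x]
        rw [map_sum]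
        refine Finset.sum_congr rfl fun i _ => ?_
        rw [mul_comm, ← smul_eq_mul, ← map_smul, ← Pi.single_smul, smul_eq_mul, mul_one]
      rw [reluFeature, h2]
    simp_rw [h1]
    exact h _
  rw [charFunDual_eq_charFun_map_one, charFunDual_eq_charFun_map_one, hL]

variable {ρ₀ : Measure (Param d)} [IsProbabilityMeasure ρ₀]

lemma integrable_of_continuous_of_norm_le_one {μ : Measure (Fin d → ℝ)} [IsFiniteMeasure μ]
    (hμ : ∀ᵐ x ∂μ, ‖x‖ ≤ 1) {f : (Fin d → ℝ) → ℝ} (hf : Continuous f) : Integrable f μ := by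
  have h1 : IsCompact (Metric.closedBall (0 : Fin d → ℝ) 1) := isCompact_closedBall _ _
  obtain ⟨C, hC⟩ := h1.exists_bound_of_continuousOn hf.continuousOn
  refine Integrable.of_bound hf.aestronglyMeasurable C ?_
  filter_upwards [hμ] with x hx
  exact hC x (by simpa using hx)

/-- If `θ` is in the support of `ρ₀`, its feature is approximated by the random feature potential
of the normalized indicator of a small ball around `θ`. -/
lemma exists_potential_near_reluFeature (hρ : ∀ᵐ θ ∂ρ₀, l1Norm θ ≤ 1) {θ : Param d}
    (hθ : θ ∈ ρ₀.support) {ε : ℝ} (hε : 0 < ε) :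
    ∃ c : Lp ℝ 2 ρ₀, ∀ x : Fin d → ℝ, ‖x‖ ≤ 1 → |potential ρ₀ c x - reluFeature θ x| ≤ ε := by
  -- The factor d + 1 compares the ℓ¹ norm with the sup norm on parameters.
  set r := ε / (d + 1)
  have hr : 0 < r := by positivity
  set B := Metric.ball θ r
  have hBpos : 0 < ρ₀ B := (Measure.mem_support_iff_forall θ).1 hθ _ (Metric.ball_mem_nhds θ hr)
  have hB : 0 < ρ₀.real B := ENNReal.toReal_pos hBpos.ne' (measure_ne_top _ _)
  have hBm : MeasurableSet B := Metric.isOpen_ball.measurableSet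
  refine ⟨indicatorConstLp 2 hBm (measure_ne_top _ _) (ρ₀.real B)⁻¹, fun x hx => ?_⟩
  have h1 : potential ρ₀ (indicatorConstLp 2 hBm (measure_ne_top _ _) (ρ₀.real B)⁻¹) x
      = ⨍ θ' in B, reluFeature θ' x ∂ρ₀ := by
    rw [setAverage_eq, smul_eq_mul, potential, ← integral_const_mul, ← integral_indicator hBm]
    refine integral_congr_ae ?_
    filter_upwards [indicatorConstLp_coeFn (p := 2) (hs := hBm) (hμs := measure_ne_top ρ₀ B)
      (c := (ρ₀.real B)⁻¹)] with θ' h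
    rw [h]
    by_cases hm : θ' ∈ B <;> simp [hm]
  have hi : IntegrableOn (fun θ' => reluFeature θ' x) B ρ₀ :=
    ((memLp_reluFeature hρ x).integrable (by norm_num)).integrableOn
  have h2 : ⨍ θ' in B, reluFeature θ' x ∂ρ₀ ∈ Metric.closedBall (reluFeature θ x) ε := by
    refine Convex.set_average_mem (convex_closedBall _ _) Metric.isClosed_closedBall hBpos.ne'
      (measure_ne_top _ _) ?_ hi
    refine (ae_restrict_iff' hBm).2 (Eventually.of_forall fun θ' hθ' => ?_)
    rw [Metric.mem_closedBall, Real.dist_eq]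
    refine (abs_reluFeature_sub_param_le θ' θ hx).trans ((l1Norm_le _).trans ?_)
    rw [Metric.mem_ball, dist_eq_norm, lt_div_iff₀ (by positivity)] at hθ'
    linarith
  rw [h1]
  rwa [Metric.mem_closedBall, Real.dist_eq] at h2

/-- A probability measure on the cube is determined by its integrals of random feature
potentials, if the random parameters cover all directions. -/
lemma measure_ext_of_integral_potential (hρ : ∀ᵐ θ ∂ρ₀, l1Norm θ ≤ 1)
    (hdir : CoversAllDirections ρ₀) {μ ν : Measure (Fin d → ℝ)} [IsProbabilityMeasure μ]
    [IsProbabilityMeasure ν] (hμ : ∀ᵐ x ∂μ, ‖x‖ ≤ 1) (hν : ∀ᵐ x ∂ν, ‖x‖ ≤ 1)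
    (h : ∀ c, ∫ x, potential ρ₀ c x ∂μ = ∫ x, potential ρ₀ c x ∂ν) : μ = ν := by
  have hsupp : ∀ θ ∈ ρ₀.support, ∫ x, reluFeature θ x ∂μ = ∫ x, reluFeature θ x ∂ν := by
    intro θ hθ
    refine eq_of_forall_dist_le fun ε hε => ?_
    obtain ⟨c, hc⟩ := exists_potential_near_reluFeature hρ hθ (half_pos hε)
    have key : ∀ κ : Measure (Fin d → ℝ), IsProbabilityMeasure κ → (∀ᵐ x ∂κ, ‖x‖ ≤ 1) →
        |∫ x, potential ρ₀ c x ∂κ - ∫ x, reluFeature θ x ∂κ| ≤ ε / 2 := fun κ _ hκ => by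
      rw [← integral_sub (integrable_of_continuous_of_norm_le_one hκ (continuous_potential hρ c))
        (integrable_of_continuous_of_norm_le_one hκ (continuous_reluFeature_right θ))]
      have := norm_integral_le_of_norm_le_const (μ := κ) (C := ε / 2)
        (f := fun x => potential ρ₀ c x - reluFeature θ x) (by
          filter_upwards [hκ] with x hx
          exact hc x hx)
      simpa using this
    have h1 := abs_le.1 (key μ inferInstance hμ)
    have h2 := abs_le.1 (key ν inferInstance hν)
    have h3 := h c
    rw [Real.dist_eq, abs_le]
    constructor <;> linarith
  refine measure_ext_of_integral_reluFeature hμ hν fun θ => ?_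
  rcases eq_or_ne θ 0 with rfl | hθ
  · simp [reluFeature]
  -- Features are positively homogeneous in θ, so one support point on each ray suffices.
  · obtain ⟨c, hc, hcθ⟩ := hdir θ hθ
    have := hsupp _ hcθ
    simp_rw [reluFeature_smul hc.le, integral_const_mul] at this
    exact mul_left_cancel₀ hc.ne' this

end Universality

/-! ### Testing weak convergence on potentials. -/

section WeakConvergence

variable {d : ℕ} {ρ₀ : Measure (Param d)} [IsProbabilityMeasure ρ₀]

lemma abs_potential_le (hρ : ∀ᵐ θ ∂ρ₀, l1Norm θ ≤ 1) (c : Lp ℝ 2 ρ₀) {x : Fin d → ℝ}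
    (hx : ‖x‖ ≤ 1) : |potential ρ₀ c x| ≤ ‖c‖ := by
  rw [← inner_featureLp hρ]
  exact abs_inner_le_of_norm_le_one (norm_featureLp_le hρ hx) c

/-- On the cube, weak convergence of probability measures can be tested on the random feature
potentials, if the random parameters cover all directions. -/
lemma tendsto_of_tendsto_integral_potential (hρ : ∀ᵐ θ ∂ρ₀, l1Norm θ ≤ 1)
    (hdir : CoversAllDirections ρ₀) {ι : Type*} {l : Filter ι}
    {Q : ι → ProbabilityMeasure (Fin d → ℝ)} {ν : ProbabilityMeasure (Fin d → ℝ)}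
    (hQ : ∀ᶠ t in l, ∀ᵐ x ∂(Q t : Measure (Fin d → ℝ)), ‖x‖ ≤ 1)
    (hν : ∀ᵐ x ∂(ν : Measure (Fin d → ℝ)), ‖x‖ ≤ 1)
    (h : ∀ c, Tendsto (fun t => ∫ x, potential ρ₀ c x ∂(Q t : Measure (Fin d → ℝ))) l
      (𝓝 (∫ x, potential ρ₀ c x ∂(ν : Measure (Fin d → ℝ))))) :
    Tendsto Q l (𝓝 ν) := by
  set B := Metric.closedBall (0 : Fin d → ℝ) 1
  have hB : ∀ μ : Measure (Fin d → ℝ), (∀ᵐ x ∂μ, ‖x‖ ≤ 1) ↔ μ Bᶜ = 0 := fun μ => by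
    rw [ae_iff]
    congr! 3
    ext x
    simp [B]
  set S : Set (ProbabilityMeasure (Fin d → ℝ)) := {μ | (μ : Measure (Fin d → ℝ)) Bᶜ = 0}
  -- By Prokhorov it is enough to identify every cluster point with ν.
  have hS : IsCompact (closure S) := by
    refine isCompact_closure_of_isTightMeasureSet
      (isTightMeasureSet_iff_exists_isCompact_measure_compl_le.2 fun ε _ =>
        ⟨B, isCompact_closedBall _ _, ?_⟩)
    rintro _ ⟨μ, hμ, rfl⟩
    have hμ' : (μ : Measure (Fin d → ℝ)) Bᶜ = 0 := hμ
    rw [hμ']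
    exact zero_le
  refine hS.tendsto_nhds_of_unique_mapClusterPt
    (hQ.mono fun t ht => subset_closure ((hB _).1 ht)) fun κ _ hκ => ?_
  obtain ⟨U, hU, hκU⟩ := mapClusterPt_iff_ultrafilter.1 hκ
  have hQU := hU hQ
  have hκB : ∀ᵐ x ∂(κ : Measure (Fin d → ℝ)), ‖x‖ ≤ 1 := by
    have h1 := ProbabilityMeasure.limsup_measure_closed_le_of_tendsto hκU
      (F := B) Metric.isClosed_closedBall
    have h2 : (fun t => (Q t : Measure (Fin d → ℝ)) B) =ᶠ[(U : Filter ι)] fun _ => 1 := by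
      filter_upwards [hQU] with t ht
      exact (prob_compl_eq_zero_iff Metric.isClosed_closedBall.measurableSet).1 ((hB _).1 ht)
    rw [limsup_congr h2, limsup_const] at h1
    exact (hB _).2 ((prob_compl_eq_zero_iff Metric.isClosed_closedBall.measurableSet).2
      (le_antisymm prob_le_one h1))
  suffices h0 : (κ : Measure (Fin d → ℝ)) = ν from Subtype.ext h0
  refine measure_ext_of_integral_potential hρ hdir hκB hν fun c => ?_
  -- Potentials may be unbounded on the whole space; precomposing with the retraction onto the cube
  -- gives bounded test functions.
  let clip : (Fin d → ℝ) → Fin d → ℝ := fun x i => max (-1) (min (x i) 1)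
  have hclip : Continuous clip := by fun_prop
  have hclip1 : ∀ x, ‖clip x‖ ≤ 1 := fun x =>
    norm_le_one_of_mem_cube ⟨fun i => le_max_left _ _, fun i =>
      max_le (by norm_num) (min_le_right _ _)⟩
  have hclip2 : ∀ x, ‖x‖ ≤ 1 → clip x = x := fun x hx => by
    ext i
    have h1 := abs_le.1 ((norm_le_pi_norm x i).trans hx)
    simp only [clip]
    rw [min_eq_left h1.2, max_eq_right h1.1]
  let f : BoundedContinuousFunction (Fin d → ℝ) ℝ :=
    BoundedContinuousFunction.ofNormedAddCommGroup (fun x => potential ρ₀ c (clip x))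
      ((continuous_potential hρ c).comp hclip) ‖c‖ fun x => abs_potential_le hρ c (hclip1 x)
  have hf : ∀ μ : Measure (Fin d → ℝ), (∀ᵐ x ∂μ, ‖x‖ ≤ 1) →
      ∫ x, f x ∂μ = ∫ x, potential ρ₀ c x ∂μ := fun μ hμ => by
    refine integral_congr_ae ?_
    filter_upwards [hμ] with x hx
    simp [f, hclip2 x hx]
  have h1 := (ProbabilityMeasure.tendsto_iff_forall_integral_tendsto.1 hκU) f
  rw [hf _ hκB] at h1
  refine tendsto_nhds_unique (h1.congr' ?_) ((h c).mono_left hU)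
  filter_upwards [hQU] with t ht
  exact hf _ ht

end WeakConvergence

/-! ### Divergence of the Kullback–Leibler distance. -/

section KullbackLeibler

open InformationTheory

/-- Young's inequality: exp y - 1 is the convex conjugate of `klFun`. -/
lemma InformationTheory.mul_sub_exp_le_klFun {x : ℝ} (hx : 0 ≤ x) (y : ℝ) :
    x * y - (Real.exp y - 1) ≤ klFun x := by
  rw [klFun_apply]
  rcases hx.eq_or_lt with rfl | hx
  · simp [(Real.exp_pos y).le]
  · have h1 := Real.add_one_le_exp (y - Real.log x)
    rw [Real.exp_sub, Real.exp_log hx, le_div_iff₀ hx] at h1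
    linarith

/-- A form of the Donsker–Varadhan lower bound for the Kullback–Leibler divergence. -/
lemma InformationTheory.integral_sub_le_klDiv {X : Type*} [TopologicalSpace X] [MeasurableSpace X]
    [OpensMeasurableSpace X] (μ ν : Measure X) [IsProbabilityMeasure μ] [IsProbabilityMeasure ν]
    {f : X → ℝ} (hf : Continuous f) {C : ℝ} (hfC : ∀ x, |f x| ≤ C) :
    ENNReal.ofReal (∫ x, f x ∂μ - ∫ x, (Real.exp (f x) - 1) ∂ν) ≤ klDiv μ ν := by
  classical
  rw [klDiv_eq_integral_klFun]
  split_ifs with h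
  swap
  · exact le_top
  have h1 : ∫ x, f x ∂μ = ∫ x, (μ.rnDeriv ν x).toReal * f x ∂ν :=
    (integral_rnDeriv_smul h.1).symm
  have hi1 : Integrable (fun x => (μ.rnDeriv ν x).toReal * f x) ν :=
    Measure.integrable_toReal_rnDeriv.mul_bdd (c := C) hf.aestronglyMeasurable
      (Eventually.of_forall hfC)
  have hi2 : Integrable (fun x => Real.exp (f x) - 1) ν := by
    refine (Integrable.of_bound (by fun_prop : Continuous fun x => Real.exp (f x)).aestronglyMeasurable
      (Real.exp C) (Eventually.of_forall fun x => ?_)).sub (integrable_const 1)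
    rw [Real.norm_of_nonneg (Real.exp_pos _).le]
    exact Real.exp_le_exp.2 ((le_abs_self _).trans (hfC x))
  rw [h1, ← integral_sub hi1 hi2]
  exact ENNReal.ofReal_le_ofReal (integral_mono (hi1.sub hi2)
    ((integrable_klFun_rnDeriv_iff h.1).2 h.2) fun x =>
      mul_sub_exp_le_klFun ENNReal.toReal_nonneg _)

/-- If `Q t` converges weakly to `ν`, and `ν` is concentrated on the zeros of a continuous function
`0 ≤ g ≤ 1` that is not `μ`-almost surely zero, then `KL(μ ‖ Q t)` tends to infinity. -/
lemma tendsto_klDiv_top {X ι : Type*} [TopologicalSpace X] [MeasurableSpace X]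
    [OpensMeasurableSpace X] {l : Filter ι} {Q : ι → ProbabilityMeasure X}
    {ν : ProbabilityMeasure X} (hQ : Tendsto Q l (𝓝 ν)) (μ : Measure X) [IsProbabilityMeasure μ]
    {g : X → ℝ} (hg : Continuous g) (hg0 : ∀ x, 0 ≤ g x) (hg1 : ∀ x, g x ≤ 1)
    (hgν : ∀ᵐ x ∂(ν : Measure X), g x = 0) (hgμ : 0 < ∫ x, g x ∂μ) :
    Tendsto (fun t => klDiv μ (Q t)) l (𝓝 ⊤) := by
  rw [ENNReal.tendsto_nhds_top_iff_nnreal]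
  intro M
  -- With f = k·g the first term of the lower bound is M + 2, while the subtracted one tends to 0
  -- and is eventually below 1.
  set k : ℝ := (M + 2) / ∫ x, g x ∂μ
  have hk : 0 ≤ k := by positivity
  let F : BoundedContinuousFunction X ℝ :=
    BoundedContinuousFunction.ofNormedAddCommGroup (fun x => Real.exp (k * g x) - 1)
      (by fun_prop) (Real.exp k) fun x => by
        have h1 : k * g x ≤ k := mul_le_of_le_one_right hk (hg1 x)
        have h2 : 0 ≤ k * g x := mul_nonneg hk (hg0 x)
        rw [Real.norm_of_nonneg (by linarith [Real.one_le_exp h2])]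
        linarith [Real.exp_le_exp.2 h1]
  have h1 := (ProbabilityMeasure.tendsto_iff_forall_integral_tendsto.1 hQ) F
  have h2 : ∫ x, F x ∂(ν : Measure X) = 0 := by
    refine integral_eq_zero_of_ae ?_
    filter_upwards [hgν] with x hx
    simp [F, hx]
  rw [h2] at h1
  filter_upwards [h1.eventually_lt_const one_pos] with t ht
  refine lt_of_lt_of_le ?_ (integral_sub_le_klDiv μ (Q t) (f := fun x => k * g x) (by fun_prop)
    (C := k) fun x => ?_)
  · rw [integral_const_mul, div_mul_cancel₀ _ hgμ.ne', ENNReal.lt_ofReal_iff_toReal_lt (by simp)]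
    have ht' : ∫ x, (Real.exp (k * g x) - 1) ∂(Q t : Measure X) < 1 := ht
    simp only [ENNReal.coe_toReal]
    linarith
  · rw [abs_of_nonneg (mul_nonneg hk (hg0 x))]
    exact mul_le_of_le_one_right hk (hg1 x)

end KullbackLeibler

/-! ### Empirical distributions. -/

section Empirical

variable {d n : ℕ}

lemma integral_empiricalDist (hn : 0 < n) (x : Fin n → Fin d → ℝ) (f : (Fin d → ℝ) → ℝ) :
    ∫ y, f y ∂(empiricalDist hn x : Measure (Fin d → ℝ)) = (n : ℝ)⁻¹ * ∑ i, f (x i) := by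
  have h : (empiricalDist hn x : Measure (Fin d → ℝ)) =
    (n : ℝ≥0∞)⁻¹ • ∑ i, Measure.dirac (x i) := rfl
  rw [h, integral_smul_measure, integral_finsetSum_measure fun i _ => integrable_dirac (by simp)]
  simp

lemma ae_empiricalDist (hn : 0 < n) (x : Fin n → Fin d → ℝ) {p : (Fin d → ℝ) → Prop}
    (hp : ∀ i, p (x i)) : ∀ᵐ y ∂(empiricalDist hn x : Measure (Fin d → ℝ)), p y := by
  have h : (empiricalDist hn x : Measure (Fin d → ℝ)) =
    (n : ℝ≥0∞)⁻¹ • ∑ i, Measure.dirac (x i) := rfl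
  rw [h]
  refine Measure.ae_smul_measure ?_ _
  rw [ae_iff, Measure.finsetSum_apply]
  refine Finset.sum_eq_zero fun i _ => ?_
  rw [← ae_iff, ae_dirac_eq]
  exact hp i

lemma inv_le_empiricalDist (hn : 0 < n) (x : Fin n → Fin d → ℝ) (i : Fin n)
    {U : Set (Fin d → ℝ)} (hU : x i ∈ U) :
    (n : ℝ≥0∞)⁻¹ ≤ (empiricalDist hn x : Measure (Fin d → ℝ)) U := by
  have h : (empiricalDist hn x : Measure (Fin d → ℝ)) =
    (n : ℝ≥0∞)⁻¹ • ∑ i, Measure.dirac (x i) := rfl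
  rw [h, Measure.smul_apply, Measure.finsetSum_apply, smul_eq_mul]
  refine le_mul_of_one_le_right' ?_
  refine le_trans ?_ (Finset.single_le_sum (f := fun j => Measure.dirac (x j) U)
    (fun _ _ => zero_le) (Finset.mem_univ i))
  simp [Measure.dirac_apply_of_mem hU]

end Empirical

/-! ### Sublinear lower bound for the empirical loss. -/

section LowerBound

variable {E X : Type*} [NormedAddCommGroup E] [InnerProductSpace ℝ E]
  [PseudoMetricSpace X] [MeasurableSpace X] [OpensMeasurableSpace X] {P : Measure X}
  [IsProbabilityMeasure P] {φ : X → E}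

/-- The partition function is at least what a small ball around a point of the support yields. -/
lemma exists_le_log_integral_exp_neg_inner (hφ : AEStronglyMeasurable φ P)
    (hφ1 : ∀ᵐ x ∂P, ‖φ x‖ ≤ 1) (hlip : ∀ x y, ‖φ x - φ y‖ ≤ dist x y) {x : X}
    (hx : x ∈ P.support) {r : ℝ} (hr : 0 < r) :
    ∃ C, ∀ c : E, -C - r * ‖c‖ - inner ℝ (φ x) c ≤
      Real.log (∫ y, Real.exp (-inner ℝ (φ y) c) ∂P) := by
  set B := Metric.ball x r
  have hB : 0 < P.real B := ENNReal.toReal_pos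
    ((Measure.mem_support_iff_forall x).1 hx _ (Metric.ball_mem_nhds x hr)).ne' (measure_ne_top _ _)
  have hBm : MeasurableSet B := Metric.isOpen_ball.measurableSet
  -- On the ball, ⟪φ y, c⟫ exceeds ⟪φ x, c⟫ by at most r‖c‖: the radius becomes the slope, and the
  -- mass of the ball the constant.
  refine ⟨-Real.log (P.real B), fun c => ?_⟩
  rw [Real.le_log_iff_exp_le (integral_exp_neg_inner_pos hφ hφ1 c), neg_neg, sub_sub, Real.exp_sub,
    Real.exp_log hB, div_eq_mul_inv, ← Real.exp_neg]
  calc P.real B * Real.exp (-(r * ‖c‖ + inner ℝ (φ x) c))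
      = ∫ y, B.indicator (fun _ => Real.exp (-(r * ‖c‖ + inner ℝ (φ x) c))) y ∂P := by
        rw [integral_indicator_const _ hBm, smul_eq_mul]
    _ ≤ _ := by
        refine integral_mono ((integrable_const _).indicator hBm)
          (integrable_exp_neg_inner hφ hφ1 c) fun y => ?_
        by_cases hy : y ∈ B
        · simp only [hy, indicator_of_mem]
          refine Real.exp_le_exp.2 (neg_le_neg ?_)
          have h1 : inner ℝ (φ y - φ x) c ≤ r * ‖c‖ :=
            (real_inner_le_norm _ _).trans (by
              gcongr
              exact (hlip y x).trans (Metric.mem_ball.1 hy).le)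
          rw [inner_sub_left] at h1
          linarith
        · simp only [hy, not_false_eq_true, indicator_of_notMem]
          exact (Real.exp_pos _).le

/-- The negative part of the empirical loss grows sublinearly. -/
lemma exists_le_empiricalLoss (hφ : AEStronglyMeasurable φ P)
    (hφ1 : ∀ᵐ x ∂P, ‖φ x‖ ≤ 1) (hlip : ∀ x y, ‖φ x - φ y‖ ≤ dist x y) {n : ℕ} (hn : 0 < n)
    {x : Fin n → X} (hx : ∀ i, x i ∈ P.support) {r : ℝ} (hr : 0 < r) :
    ∃ C, ∀ c : E, -C - r * ‖c‖ ≤ inner ℝ ((n : ℝ)⁻¹ • ∑ i, φ (x i)) c +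
      Real.log (∫ y, Real.exp (-inner ℝ (φ y) c) ∂P) := by
  choose C hC using fun i => exists_le_log_integral_exp_neg_inner hφ hφ1 hlip (hx i) hr
  refine ⟨(n : ℝ)⁻¹ * ∑ i, C i, fun c => ?_⟩
  have hn' : (0 : ℝ) < n := Nat.cast_pos.2 hn
  -- After averaging, the terms ⟪φ (x i), c⟫ cancel the linear part of the loss.
  have h1 := Finset.sum_le_sum fun i (_ : i ∈ Finset.univ) => hC i c
  simp only [Finset.sum_sub_distrib, Finset.sum_neg_distrib, Finset.sum_const, Finset.card_univ,
    Fintype.card_fin, nsmul_eq_mul] at h1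
  rw [real_inner_smul_left, sum_inner]
  have h2 := mul_le_mul_of_nonneg_left h1 (inv_pos.2 hn').le
  rw [mul_sub, mul_sub, inv_mul_cancel_left₀ hn'.ne', inv_mul_cancel_left₀ hn'.ne'] at h2
  linarith

end LowerBound

/-! ### The uniform base distribution. -/

section Uniform

variable {d : ℕ} {K : Set (Fin d → ℝ)}

lemma isProbabilityMeasure_uniformDist (hK : IsCompact K) (hK_pos : 0 < volume K) :
    IsProbabilityMeasure (uniformDist K) :=
  ⟨by simp [uniformDist, ENNReal.inv_mul_cancel hK_pos.ne' hK.measure_lt_top.ne]⟩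

lemma uniformDist_absolutelyContinuous : uniformDist K ≪ volume :=
  (Measure.smul_absolutelyContinuous).trans Measure.restrict_le_self.absolutelyContinuous

lemma ae_mem_uniformDist (hK : IsCompact K) : ∀ᵐ x ∂uniformDist K, x ∈ K :=
  Measure.ae_smul_measure (ae_restrict_mem hK.measurableSet) _

lemma support_uniformDist_subset (hK : IsCompact K) : (uniformDist K).support ⊆ K :=
  Measure.support_subset_of_isClosed hK.isClosed (ae_mem_uniformDist hK)

/-- Positive dimension matters: for d = 0 the only point of the space is an atom. -/
lemma uniformDist_singleton (hd : 0 < d) (x : Fin d → ℝ) : uniformDist K {x} = 0 := by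
  have : Nonempty (Fin d) := ⟨⟨0, hd⟩⟩
  exact uniformDist_absolutelyContinuous (measure_singleton x)

end Uniform

/-! ### The RKHS norm against the parameter norm. -/

section RKHSNorm

variable {d : ℕ} {ρ₀ : Measure (Param d)}

lemma rkhsNorm_potential_le (K : Set (Fin d → ℝ)) (c : Lp ℝ 2 ρ₀) :
    rkhsNorm ρ₀ K (potential ρ₀ c) ≤ ENNReal.ofReal ‖c‖ := by
  refine (iInf₂_le c fun _ _ => rfl).trans ?_
  rw [← Lp.enorm_def, ofReal_norm]

lemma exists_norm_le_of_rkhsNorm_lt {K : Set (Fin d → ℝ)} {V : (Fin d → ℝ) → ℝ} {R : ℝ}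
    (h : rkhsNorm ρ₀ K V < ENNReal.ofReal R) :
    ∃ c : Lp ℝ 2 ρ₀, (∀ x ∈ K, V x = potential ρ₀ c x) ∧ ‖c‖ ≤ R := by
  obtain ⟨c, hc⟩ := iInf_lt_iff.1 h
  obtain ⟨hcK, hc⟩ := iInf_lt_iff.1 hc
  rw [← Lp.enorm_def, ← ofReal_norm] at hc
  exact ⟨c, hcK, (ENNReal.ofReal_lt_ofReal_iff'.1 hc).1.le⟩

end RKHSNorm

/-! ### Memorization and blow-up of the RKHS norm. -/

section Dynamics

variable {d : ℕ} {ρ₀ : Measure (Param d)} [IsProbabilityMeasure ρ₀] {P : Measure (Fin d → ℝ)}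

lemma IsDistributionOfPotential.absolutelyContinuous {V : (Fin d → ℝ) → ℝ}
    {Q : ProbabilityMeasure (Fin d → ℝ)} (hQ : IsDistributionOfPotential P V Q) :
    (Q : Measure (Fin d → ℝ)) ≪ P := by
  rw [show (Q : Measure (Fin d → ℝ)) = _ from hQ]
  exact withDensity_absolutelyContinuous _ _

lemma IsDistributionOfPotential.congr {V W : (Fin d → ℝ) → ℝ} (h : V =ᵐ[P] W)
    {Q : ProbabilityMeasure (Fin d → ℝ)} (hQ : IsDistributionOfPotential P V Q) :
    IsDistributionOfPotential P W Q := by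
  have h1 : (fun x => Real.exp (-V x)) =ᵐ[P] fun x => Real.exp (-W x) := by
    filter_upwards [h] with x hx
    rw [hx]
  rw [IsDistributionOfPotential, show (Q : Measure (Fin d → ℝ)) = _ from hQ, integral_congr_ae h1]
  refine withDensity_congr_ae ?_
  filter_upwards [h] with x hx
  rw [hx]

lemma IsDistributionOfPotential.eq_withDensity (hρ : ∀ᵐ θ ∂ρ₀, l1Norm θ ≤ 1) {c : Lp ℝ 2 ρ₀}
    {Q : ProbabilityMeasure (Fin d → ℝ)} (hQ : IsDistributionOfPotential P (potential ρ₀ c) Q) :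
    (Q : Measure (Fin d → ℝ)) =
      P.withDensity fun x => ENNReal.ofReal (gibbsDensity P (featureLp hρ) c x) := by
  simp only [gibbsDensity, inner_featureLp hρ]
  exact hQ

variable [IsProbabilityMeasure P]

lemma IsDistributionOfPotential.integral_eq (hρ : ∀ᵐ θ ∂ρ₀, l1Norm θ ≤ 1)
    (hP : ∀ᵐ x ∂P, ‖x‖ ≤ 1) {c : Lp ℝ 2 ρ₀}
    {Q : ProbabilityMeasure (Fin d → ℝ)} (hQ : IsDistributionOfPotential P (potential ρ₀ c) Q)
    (f : (Fin d → ℝ) → ℝ) :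
    ∫ x, f x ∂(Q : Measure (Fin d → ℝ)) = ∫ x, gibbsDensity P (featureLp hρ) c x * f x ∂P := by
  have h1 := integrable_gibbsDensity (continuous_featureLp hρ).aestronglyMeasurable
    (hP.mono fun x hx => norm_featureLp_le hρ hx) c
  rw [hQ.eq_withDensity hρ, integral_withDensity_eq_integral_toReal_smul₀
    h1.aemeasurable.ennreal_ofReal (by simp)]
  refine integral_congr_ae (Eventually.of_forall fun x => ?_)
  simp only [smul_eq_mul]
  rw [ENNReal.toReal_ofReal (gibbsDensity_nonneg c x)]

/-- A potential of small norm generates a distribution with bounded density. -/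
lemma IsDistributionOfPotential.measure_le (hρ : ∀ᵐ θ ∂ρ₀, l1Norm θ ≤ 1)
    (hP : ∀ᵐ x ∂P, ‖x‖ ≤ 1) {c : Lp ℝ 2 ρ₀}
    {Q : ProbabilityMeasure (Fin d → ℝ)} (hQ : IsDistributionOfPotential P (potential ρ₀ c) Q)
    {U : Set (Fin d → ℝ)} (hU : MeasurableSet U) :
    (Q : Measure (Fin d → ℝ)) U ≤ ENNReal.ofReal (Real.exp (2 * ‖c‖)) * P U := by
  rw [hQ.eq_withDensity hρ, withDensity_apply _ hU, ← setLIntegral_const]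
  refine lintegral_mono_ae (ae_restrict_of_ae ?_)
  filter_upwards [hP] with x hx
  exact ENNReal.ofReal_le_ofReal (gibbsDensity_le (continuous_featureLp hρ).aestronglyMeasurable
    (hP.mono fun x hx => norm_featureLp_le hρ hx) c (norm_featureLp_le hρ hx))

/-- Gradient descent on the empirical loss memorizes: the generated distribution converges weakly
to the empirical distribution of the sample points. -/
theorem tendsto_empiricalDist (hρ : ∀ᵐ θ ∂ρ₀, l1Norm θ ≤ 1) (hdir : CoversAllDirections ρ₀)
    (hP : ∀ᵐ x ∂P, ‖x‖ ≤ 1) {n : ℕ} (hn : 0 < n) {x : Fin n → Fin d → ℝ}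
    (hx : ∀ i, x i ∈ P.support) (hx1 : ∀ i, ‖x i‖ ≤ 1) {a : ℝ → Lp ℝ 2 ρ₀}
    (ha : IsGradientFlow
      (fun c : Lp ℝ 2 ρ₀ => biasLoss P (empiricalDist hn x) (potential ρ₀ c)) a)
    {Q : ℝ → ProbabilityMeasure (Fin d → ℝ)}
    (hQ : ∀ t : ℝ, 0 ≤ t → IsDistributionOfPotential P (potential ρ₀ (a t)) (Q t)) :
    Tendsto Q atTop (𝓝 (empiricalDist hn x)) := by
  set φ := featureLp hρ
  have hφ : AEStronglyMeasurable φ P := (continuous_featureLp hρ).aestronglyMeasurable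
  have hφ1 : ∀ᵐ x ∂P, ‖φ x‖ ≤ 1 := hP.mono fun x hx => norm_featureLp_le hρ hx
  set m := (n : ℝ)⁻¹ • ∑ i, φ (x i)
  have hm : ∀ c, inner ℝ m c =
      ∫ y, potential ρ₀ c y ∂(empiricalDist hn x : Measure (Fin d → ℝ)) := fun c => by
    rw [integral_empiricalDist, real_inner_smul_left, sum_inner]
    simp_rw [φ, inner_featureLp]
  have hL : (fun c : Lp ℝ 2 ρ₀ => biasLoss P (empiricalDist hn x) (potential ρ₀ c)) =
      fun c => inner ℝ m c + Real.log (∫ x, Real.exp (-inner ℝ (φ x) c) ∂P) := by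
    funext c
    rw [hm]
    simp_rw [φ, inner_featureLp]
    rfl
  rw [hL] at ha
  have hgrad := ha.tendsto_norm_gradient (hasGradientAt_gibbsLoss hφ hφ1 m)
    (gibbsLoss_convex hφ hφ1 m)
    fun r hr => exists_le_empiricalLoss hφ hφ1 (norm_featureLp_sub_le hρ) hn hx hr
  refine tendsto_of_tendsto_integral_potential hρ hdir ?_ (ae_empiricalDist hn x hx1) fun c => ?_
  · filter_upwards [eventually_ge_atTop 0] with t ht
    exact (hQ t ht).absolutelyContinuous hP
  -- Paired with c, the gradient is the sample mean of V_c minus its mean under Q_t.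
  · have h1 := hgrad.inner (𝕜 := ℝ) (tendsto_const_nhds (x := c))
    rw [inner_zero_left] at h1
    have h2 := (tendsto_const_nhds (x := inner ℝ m c)).sub h1
    rw [sub_zero, hm] at h2
    refine h2.congr' ?_
    filter_upwards [eventually_ge_atTop 0] with t ht
    rw [inner_gibbsGradient hφ hφ1, (hQ t ht).integral_eq hρ hP, hm, sub_sub_cancel]
    simp_rw [φ, inner_featureLp]

/-- If distributions generated by potentials converge weakly to a measure with an atom, while the
base distribution has no atom there, then the RKHS norms of the potentials tend to infinity. -/
lemma tendsto_rkhsNorm_top (hρ : ∀ᵐ θ ∂ρ₀, l1Norm θ ≤ 1) {K : Set (Fin d → ℝ)}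
    (hPK : ∀ᵐ x ∂P, x ∈ K) (hP : ∀ᵐ x ∂P, ‖x‖ ≤ 1) {l : Filter ℝ} {V : ℝ → (Fin d → ℝ) → ℝ}
    {Q : ℝ → ProbabilityMeasure (Fin d → ℝ)} {ν : ProbabilityMeasure (Fin d → ℝ)}
    (hQ : ∀ᶠ t in l, IsDistributionOfPotential P (V t) (Q t)) (hlim : Tendsto Q l (𝓝 ν))
    {x : Fin d → ℝ} (hPx : P {x} = 0) (hνx : (ν : Measure (Fin d → ℝ)) {x} ≠ 0) :
    Tendsto (fun t => rkhsNorm ρ₀ K (V t)) l (𝓝 ⊤) := by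
  rw [ENNReal.tendsto_nhds_top_iff_nnreal]
  intro R
  by_contra hcon
  rw [not_eventually] at hcon
  -- A density bound for RKHS norms up to R; the `+ 1` is there because the infimum need not be
  -- attained.
  set M := ENNReal.ofReal (Real.exp (2 * (R + 1)))
  have hM : M ≠ 0 := by simp [M, Real.exp_pos]
  have hM' : M ≠ ⊤ := ENNReal.ofReal_ne_top
  -- Outer regularity makes U so small that densities below M give it less mass than the atom,
  -- against the portmanteau bound on U.
  obtain ⟨U, hxU, hU, hPU⟩ := exists_isOpen_lt_of_lt {x} ((ν : Measure (Fin d → ℝ)) {x} / M)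
    (μ := P) (by rw [hPx]; exact ENNReal.div_pos hνx hM')
  have h1 := ProbabilityMeasure.le_liminf_measure_open_of_tendsto hlim hU
  have h2 : liminf (fun t => (Q t : Measure (Fin d → ℝ)) U) l ≤ M * P U := by
    refine liminf_le_of_frequently_le' ((hcon.and_eventually hQ).mono fun t ht => ?_)
    obtain ⟨c, hcK, hc⟩ := exists_norm_le_of_rkhsNorm_lt (R := R + 1)
      ((not_lt.1 ht.1).trans_lt (by
        rw [ENNReal.lt_ofReal_iff_toReal_lt (by simp)]
        simp))
    have hc' : V t =ᵐ[P] potential ρ₀ c := hPK.mono hcK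
    refine ((ht.2.congr hc').measure_le hρ hP hU.measurableSet).trans ?_
    have hcM : ENNReal.ofReal (Real.exp (2 * ‖c‖)) ≤ M :=
      ENNReal.ofReal_le_ofReal (Real.exp_le_exp.2 (by linarith))
    gcongr
  have h3 : M * P U < (ν : Measure (Fin d → ℝ)) {x} := by
    rw [mul_comm]
    exact (ENNReal.lt_div_iff_mul_lt (Or.inl hM) (Or.inl hM')).1 hPU
  exact absurd (h1.trans h2) (not_le.2 (h3.trans_le (measure_mono hxU)))

end Dynamics

theorem mainTheorem3 {d n : ℕ} (hd : 0 < d) (hn : 0 < n)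
    (K : Set (Fin d → ℝ)) (hK : IsCompact K) (hK_cube : K ⊆ Icc (-1) 1)
    (hK_pos : 0 < volume K)
    (ρ₀ : Measure (Param d)) [IsProbabilityMeasure ρ₀]
    (hρ₀_ball : ∀ᵐ θ ∂ρ₀, l1Norm θ ≤ 1) (hρ₀_dir : CoversAllDirections ρ₀)
    (Vstar : (Fin d → ℝ) → ℝ) (hVstar : rkhsNorm ρ₀ K Vstar < ⊤)
    (Qstar : ProbabilityMeasure (Fin d → ℝ))
    (hQstar : IsDistributionOfPotential (uniformDist K) Vstar Qstar)
    (x : Fin n → Fin d → ℝ)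
    (hx : ∀ i, x i ∈ (Qstar : Measure (Fin d → ℝ)).support)
    (a : ℝ → Lp ℝ 2 ρ₀)
    (ha : IsGradientFlow
      (fun c : Lp ℝ 2 ρ₀ => biasLoss (uniformDist K) (empiricalDist hn x) (potential ρ₀ c)) a)
    (Q : ℝ → ProbabilityMeasure (Fin d → ℝ))
    (hQ : ∀ t : ℝ, 0 ≤ t → IsDistributionOfPotential (uniformDist K) (potential ρ₀ (a t)) (Q t)) :
    ((∃! ν, IsWeakLimitPoint Q ν) → Tendsto Q atTop (𝓝 (empiricalDist hn x))) ∧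
      ¬ IsWeakLimitPoint Q Qstar ∧
      Tendsto (fun t => InformationTheory.klDiv (Qstar : Measure (Fin d → ℝ)) (Q t))
        atTop (𝓝 ⊤) ∧
      Tendsto (fun t => rkhsNorm ρ₀ K (potential ρ₀ (a t))) atTop (𝓝 ⊤) ∧
      Tendsto (fun t => ‖a t‖) atTop atTop := by
  have := isProbabilityMeasure_uniformDist hK hK_pos
  have hPK := ae_mem_uniformDist hK
  have hK1 : ∀ y ∈ K, ‖y‖ ≤ 1 := fun y hy => norm_le_one_of_mem_cube (hK_cube hy)
  have hP : ∀ᵐ y ∂uniformDist K, ‖y‖ ≤ 1 := hPK.mono hK1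
  have hac := hQstar.absolutelyContinuous
  have hxP : ∀ i, x i ∈ (uniformDist K).support := fun i => hac.support_mono (hx i)
  have hlim : Tendsto Q atTop (𝓝 (empiricalDist hn x)) :=
    tendsto_empiricalDist hρ₀_ball hρ₀_dir hP hn hxP
      (fun i => hK1 _ (support_uniformDist_subset hK (hxP i))) ha hQ
  let i₀ : Fin n := ⟨0, hn⟩
  have hν0 : (empiricalDist hn x : Measure (Fin d → ℝ)) {x i₀} ≠ 0 :=
    ((ENNReal.inv_pos.2 (ENNReal.natCast_ne_top n)).trans_le
      (inv_le_empiricalDist hn x i₀ (mem_singleton _))).ne'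
  have hrkhs : Tendsto (fun t => rkhsNorm ρ₀ K (potential ρ₀ (a t))) atTop (𝓝 ⊤) :=
    tendsto_rkhsNorm_top hρ₀_ball hPK hP
      ((eventually_ge_atTop 0).mono hQ) hlim (uniformDist_singleton hd (x i₀)) hν0
  refine ⟨fun _ => hlim, fun h => ?_, ?_, hrkhs, ?_⟩
  -- A limit point of a convergent trajectory is its limit, but Q_* is absolutely continuous with
  -- respect to an atomless measure.
  · have h1 : Qstar = empiricalDist hn x := by
      obtain ⟨U, hU, hQU⟩ := mapClusterPt_iff_ultrafilter.1 h
      exact tendsto_nhds_unique hQU (hlim.mono_left hU)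
    rw [h1] at hac
    exact hν0 (hac (uniformDist_singleton hd (x i₀)))
  · set S := range x
    have hS : IsClosed S := (finite_range x).isClosed
    have hSne : S.Nonempty := ⟨x i₀, mem_range_self i₀⟩
    -- The truncated distance to the samples vanishes exactly on them, and Q_* gives them no mass.
    refine tendsto_klDiv_top hlim Qstar (g := fun y => min (Metric.infDist y S) 1)
      ((Metric.continuous_infDist_pt S).min continuous_const)
      (fun y => le_min Metric.infDist_nonneg zero_le_one) (fun y => min_le_right _ _)
      (ae_empiricalDist hn x fun i => ?_) ?_
    · simp [Metric.infDist_zero_of_mem (mem_range_self (f := x) i), S]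
    · have hQS : (Qstar : Measure (Fin d → ℝ)) S = 0 :=
        hac ((measure_mono_null (iUnion_singleton_eq_range x).symm.subset
          (measure_iUnion_null fun i => uniformDist_singleton hd (x i))))
      rw [integral_pos_iff_support_of_nonneg
        (fun y => le_min Metric.infDist_nonneg zero_le_one)
        (Integrable.of_bound ((Metric.continuous_infDist_pt S).min
          continuous_const).aestronglyMeasurable 1 (Eventually.of_forall fun y => by
            rw [Real.norm_of_nonneg (le_min Metric.infDist_nonneg zero_le_one)]
            exact min_le_right _ _))]
      have hsub : Sᶜ ⊆ Function.support fun y => min (Metric.infDist y S) 1 := fun y hy =>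
        (lt_min ((hS.notMem_iff_infDist_pos hSne).1 hy) one_pos).ne'
      refine lt_of_lt_of_le ?_ (measure_mono hsub)
      rw [(prob_compl_eq_one_iff hS.measurableSet).2 hQS]
      exact one_pos
  · rw [tendsto_atTop]
    intro b
    filter_upwards [hrkhs.eventually_const_lt (ENNReal.ofReal_lt_top (r := b))] with t ht
    exact (ENNReal.ofReal_lt_ofReal_iff'.1 (ht.trans_le (rkhsNorm_potential_le K (a t)))).1.le
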